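/- Let $\mathcal F^2$ be the Fock space of entire functions $f$ with $\int_{\mathbb C}|f(z)|^2e^{-|z|^2}\,dV(z)<\infty$, with inner product $\langle f,g\rangle=\frac1\pi\int_{\mathbb C}f(z)\overline{g(z)}e^{-|z|^2}\,dV(z)$. Let $m\ge 0$ be an integer and let $\psi,\varphi,\phi$ be entire functions such that $\psi$ has no zeros and $\phi\not\equiv 0$; if $m\ge 1$, assume moreover that $\varphi$ is not constant. The maximal multi-valued weighted composition operator $S_{\max}$ has the graph $$G(S_{\max})=\{(f,g)\in\mathcal F^2\times\mathcal F^2:\ \psi(z)f(\varphi(z))=\phi(z)g^{(m)}(z)\ \text{ for all } z\in\mathbb C\}.$$ Let $S$ be a multi-valued weighted composition operator with these symbols, that is, a multi-valued linear operator whose graph $G(S)$ is a linear subspace of $G(S_{\max})$. The adjoint $S^*$ has the graph $G(S^*)=\{(u,v)\in\mathcal F^2\times\mathcal F^2:\langle g,u\rangle=\langle f,v\rangle\ \text{ for all }(f,g)\in G(S)\}$, and $S$ is called hermitian if $G(S^*)=G(S)$. Triples of entire functions $(\psi,\varphi,\phi)$ and $(\psi_1,\varphi,\phi_1)$ with $\psi$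 and $\psi_1$ zero-free are called equivalent if $\phi/\psi=\phi_1/\psi_1$. Then $S$ is hermitian if and only if both of the following conditions hold: 1. $S=S_{\max}$; 2. there is a triple $(\psi_1,\varphi,\phi_1)$ of entire functions, with $\psi_1$ zero-free, equivalent to $(\psi,\varphi,\phi)$, and there are $A\in\mathbb R$, $C\in\mathbb R\setminus\{0\}$ and $B\in\mathbb C$ such that $$\varphi(u)=Au+B,\qquad Ce^{u\overline B}\phi_1(u)=\psi_1(u)(Au+B)^m\qquad\text{for all }u\in\mathbb C.$$ -/

import Mathlib

open MeasureTheory ComplexConjugate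

/-- The underlying linear space of the Fock (Segal-Bargmann) space: entire functions that are
square integrable with respect to the Gaussian weight. -/
def fockSubmodule : Submodule ℂ (ℂ → ℂ) where
  carrier := {f | Differentiable ℂ f ∧
    Integrable (fun z : ℂ => ‖f z‖ ^ 2 * Real.exp (-‖z‖ ^ 2)) volume}
  zero_mem' := by
    refine ⟨differentiable_const 0, ?_⟩
    simp
  add_mem' := by
    rintro f g ⟨hf, hfi⟩ ⟨hg, hgi⟩
    refine ⟨hf.add hg, ((hfi.add hgi).const_mul 2).mono' ?_ (Filter.Eventually.of_forall ?_)⟩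
    · have h := (hf.add hg).continuous
      exact Continuous.aestronglyMeasurable
        ((h.norm.pow 2).mul (by fun_prop))
    · intro z
      have h1 : ‖f z + g z‖ ^ 2 ≤ 2 * (‖f z‖ ^ 2 + ‖g z‖ ^ 2) := by
        have h := norm_add_le (f z) (g z)
        nlinarith [norm_nonneg (f z + g z), sq_nonneg (‖f z‖ - ‖g z‖)]
      have h2 := (Real.exp_pos (-‖z‖ ^ 2)).le
      have h3 : 0 ≤ ‖f z + g z‖ ^ 2 * Real.exp (-‖z‖ ^ 2) := by positivity
      simp only [Pi.add_apply, Real.norm_eq_abs]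
      rw [abs_of_nonneg h3]
      nlinarith [mul_le_mul_of_nonneg_right h1 h2]
  smul_mem' := by
    rintro c f ⟨hf, hfi⟩
    refine ⟨hf.const_smul c, ?_⟩
    have := hfi.const_mul (‖c‖ ^ 2)
    simpa [mul_pow, mul_assoc] using this

/-- The Fock space `𝓕²`. It carries the Gaussian inner product below, and not the product topology
of `ℂ → ℂ`. -/
def FockSpace : Type := fockSubmodule

namespace FockSpace

noncomputable instance : AddCommGroup FockSpace :=
  inferInstanceAs (AddCommGroup fockSubmodule)

noncomputable instance : Module ℂ FockSpace :=
  inferInstanceAs (Module ℂ fockSubmodule)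

/-- The entire function underlying an element of the Fock space. -/
def toFun (f : FockSpace) : ℂ → ℂ := f.1

instance : CoeFun FockSpace (fun _ => ℂ → ℂ) := ⟨toFun⟩

theorem ext {f g : FockSpace} (h : ∀ z, f z = g z) : f = g := Subtype.ext (funext h)

@[simp] theorem add_apply (f g : FockSpace) (z : ℂ) : (f + g) z = f z + g z := rfl

@[simp] theorem smul_apply (c : ℂ) (f : FockSpace) (z : ℂ) : (c • f) z = c * f z := rfl

@[simp] theorem zero_apply (z : ℂ) : (0 : FockSpace) z = 0 := rfl

theorem differentiable (f : FockSpace) : Differentiable ℂ f := f.2.1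

theorem integrable_sq (f : FockSpace) :
    Integrable (fun z : ℂ => ‖f z‖ ^ 2 * Real.exp (-‖z‖ ^ 2)) volume := f.2.2

theorem integrable_inner (f g : FockSpace) :
    Integrable (fun z : ℂ => conj (f z) * g z * (Real.exp (-‖z‖ ^ 2) : ℂ)) volume := by
  refine (f.integrable_sq.add g.integrable_sq).mono' ?_ (Filter.Eventually.of_forall ?_)
  · have := f.differentiable.continuous
    have := g.differentiable.continuous
    exact Continuous.aestronglyMeasurable (by fun_prop)
  · intro z
    have h2 := (Real.exp_pos (-‖z‖ ^ 2)).le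
    rw [norm_mul, norm_mul, RCLike.norm_conj, Complex.norm_real, Real.norm_eq_abs,
      abs_of_nonneg h2, Pi.add_apply, ← add_mul]
    refine mul_le_mul_of_nonneg_right ?_ h2
    nlinarith [sq_nonneg (‖f z‖ - ‖g z‖), mul_nonneg (norm_nonneg (f z)) (norm_nonneg (g z))]

/-- The Gaussian inner product `π⁻¹ ∫ conj (f z) * g z * exp (-|z|²) dV(z)`; following Mathlib it is
conjugate-linear in its first argument. -/
noncomputable instance : Inner ℂ FockSpace where
  inner f g := (Real.pi : ℂ)⁻¹ *
    ∫ z : ℂ, conj (f z) * g z * (Real.exp (-‖z‖ ^ 2) : ℂ)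

theorem inner_def (f g : FockSpace) : inner ℂ f g = (Real.pi : ℂ)⁻¹ *
    ∫ z : ℂ, conj (f z) * g z * (Real.exp (-‖z‖ ^ 2) : ℂ) := rfl

theorem inner_self (f : FockSpace) : inner ℂ f f =
    ((Real.pi⁻¹ * ∫ z : ℂ, ‖f z‖ ^ 2 * Real.exp (-‖z‖ ^ 2) : ℝ) : ℂ) := by
  rw [inner_def, Complex.ofReal_mul, Complex.ofReal_inv]
  congr 1
  have h : (fun z : ℂ => conj (f z) * f z * (Real.exp (-‖z‖ ^ 2) : ℂ)) =
      fun z : ℂ => ((‖f z‖ ^ 2 * Real.exp (-‖z‖ ^ 2) : ℝ) : ℂ) := by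
    funext z
    rw [Complex.conj_mul']
    push_cast
    rfl
  rw [h]
  exact integral_ofReal

noncomputable instance core : InnerProductSpace.Core ℂ FockSpace where
  conj_inner_symm f g := by
    simp only [inner_def, map_mul, map_inv₀, Complex.conj_ofReal]
    rw [← integral_conj]
    congr 2
    funext z
    simp only [map_mul, Complex.conj_conj, Complex.conj_ofReal]
    ring
  re_inner_nonneg f := by
    rw [inner_self]
    simp only [RCLike.re_to_complex, Complex.ofReal_re]
    exact mul_nonneg (inv_nonneg.2 Real.pi_pos.le) (integral_nonneg fun z => by positivity)
  add_left f g h := by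
    simp only [inner_def, add_apply, map_add, add_mul]
    rw [integral_add (integrable_inner f h) (integrable_inner g h), mul_add]
  smul_left f g c := by
    simp only [inner_def, smul_apply, map_mul, mul_assoc]
    rw [integral_const_mul]
    ring
  definite f h := by
    rw [inner_self, Complex.ofReal_eq_zero, mul_eq_zero] at h
    have h' := h.resolve_left (inv_ne_zero Real.pi_ne_zero)
    rw [integral_eq_zero_iff_of_nonneg (fun z => by positivity) f.integrable_sq] at h'
    have hc := f.differentiable.continuous
    have h0 := Continuous.ae_eq_iff_eq (volume : Measure ℂ) (by fun_prop) continuous_zero |>.1 h'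
    refine ext fun z => ?_
    have hz := congrFun h0 z
    simpa [(Real.exp_pos _).ne'] using hz

noncomputable instance : NormedAddCommGroup FockSpace := core.toNormedAddCommGroup

noncomputable instance : InnerProductSpace ℂ FockSpace := InnerProductSpace.ofCore core.toCore

end FockSpace

/-- A multi-valued linear operator in the Fock space, given by its graph
`{(f, g) : f ∈ dom, g ∈ S f}`, which is a linear subspace of `𝓕² × 𝓕²`. -/
abbrev MultiOp : Type := Submodule ℂ (FockSpace × FockSpace)

/-- An operator is hermitian if the graph of its adjoint, i.e. the set of all `(u, v)` with
`⟨g, u⟩ = ⟨f, v⟩` for all `(f, g)` in the graph, is its own graph. -/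
def MultiOp.IsHermitian (S : MultiOp) : Prop := Submodule.adjoint S = S

theorem MultiOp.mem_adjoint (S : MultiOp) (u v : FockSpace) :
    (u, v) ∈ Submodule.adjoint S ↔ ∀ f g, (f, g) ∈ S → inner ℂ g u = inner ℂ f v := by
  simp only [Submodule.mem_adjoint_iff, sub_eq_zero]

/-- The maximal multi-valued weighted composition operator: the pairs `(f, g)` in `𝓕² × 𝓕²` with
`psi · (f ∘ varphi) = phi · g^(m)`. -/
noncomputable def maximalOp (m : ℕ) (psi varphi phi : ℂ → ℂ) : MultiOp where
  carrier := {p | ∀ z : ℂ, psi z * p.1 (varphi z) = phi z * iteratedDeriv m p.2 z}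
  zero_mem' := by
    intro z
    have h : (((0 : FockSpace × FockSpace).2 : FockSpace) : ℂ → ℂ) = fun _ => 0 := rfl
    rw [h]
    simp
  add_mem' := by
    rintro ⟨f, g⟩ ⟨f', g'⟩ h h' z
    have e : ((g + g' : FockSpace) : ℂ → ℂ) = (g : ℂ → ℂ) + g' := rfl
    have h1 : ContDiffAt ℂ m g z := g.differentiable.contDiff.contDiffAt
    have h2 : ContDiffAt ℂ m g' z := g'.differentiable.contDiff.contDiffAt
    have hz := h z
    have hz' := h' z
    simp only [Prod.mk_add_mk, FockSpace.add_apply] at hz hz' ⊢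
    rw [e, iteratedDeriv_add h1 h2, mul_add, mul_add, hz, hz']
  smul_mem' := by
    rintro c ⟨f, g⟩ h z
    have e : ((c • g : FockSpace) : ℂ → ℂ) = c • (g : ℂ → ℂ) := rfl
    have hz := h z
    have h1 : ContDiffAt ℂ m g z := g.differentiable.contDiff.contDiffAt
    simp only [Prod.smul_mk, FockSpace.smul_apply] at hz ⊢
    rw [e, iteratedDeriv_const_smul h1 c, smul_eq_mul, mul_left_comm, hz, mul_left_comm]

/-- `S` is a multi-valued weighted composition operator induced by `psi · (f ∘ varphi) = phi · g^(m)`,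
with maximal or smaller domain and values. -/
def IsWeightedCompositionOp (m : ℕ) (psi varphi phi : ℂ → ℂ) (S : MultiOp) : Prop :=
  S ≤ maximalOp m psi varphi phi

/-- Two triples of symbols (with zero-free `psi`, `psi₁`) are equivalent if they have the same `varphi` and
`phi / psi = phi₁ / psi₁`. -/
def SymbolsEquivalent (psi varphi phi psi₁ varphi₁ phi₁ : ℂ → ℂ) : Prop :=
  varphi₁ = varphi ∧ ∀ z : ℂ, phi z / psi z = phi₁ z / psi₁ z

/-! Put `θ = phi / psi`. The function `u ^ m * exp (u * conj z)` represents `g ↦ g^(m)(z)`, so the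
relation `f (varphi z) = θ z * g^(m)(z)` says that `(f, g)` is orthogonal, in the sense of the
adjoint, to a pair of kernels attached to `z` (`kernelPair`). Hence the adjoint of every such `S`
contains all these pairs, and a pair `(f, g)` passing the test against all of them lies in the
maximal operator.

If `S` is hermitian, the kernel pairs lie in `S` and so satisfy the defining relation of the maximal
operator. This is a functional equation in `z` and `u`; comparing it at two values of `z` forces
`varphi` to be affine, and its hermitian symmetry makes `A` and `C` real
(`symbols_of_functional_equation`).

Conversely, for such symbols the kernel pairs lie in the maximal operator, so its adjoint is
contained in it. The other inclusion is its symmetry (`inner_comm_of_affine`). For `A ≠ 0`, the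
first components of its pairs are divisible by `z ^ m`; since multiplication by `z ^ m` is adjoint
to the `m`-th derivative, the claim reduces to the symmetry of `Q ↦ exp (u * conj B) * Q (A * u +
B)`. This operator is unbounded in general, so symmetry is proved for `|A| ≤ 1` with the weights
`exp (-t|z|²)`, `t > 1`, followed by `t → 1`; for `|A| > 1` the inverse operator, which has the same
form, is used.

Finally `S ≤ T` with both `S` and `T` hermitian gives `T = T* ≤ S* = S`. -/

/-! ### Gaussian integrals and the reproducing formula -/

theorem ofReal_exp_neg_mul_sq_norm (t : ℝ) (z : ℂ) :
    ((Real.exp (-(t * ‖z‖ ^ 2)) : ℝ) : ℂ) = Complex.exp (-(t * (z * conj z))) := by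
  rw [Complex.mul_conj']
  push_cast
  rfl

/-- Polarisation exhibits a Gaussian in `z - w`, which turns kernel estimates into convolution
estimates. -/
theorem norm_exp_mul_conj (z w : ℂ) :
    ‖Complex.exp (z * conj w)‖ =
      Real.exp (‖z‖ ^ 2 / 2 + ‖w‖ ^ 2 / 2 - ‖z - w‖ ^ 2 / 2) := by
  rw [Complex.norm_exp]
  congr 1
  simp only [Complex.sq_norm, Complex.normSq_apply, Complex.mul_re, Complex.conj_re,
    Complex.conj_im, Complex.sub_re, Complex.sub_im]
  ring

theorem integrable_exp_neg_mul_sq_norm_add {c : ℝ} (hc : 0 < c) (β : ℝ) :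
    Integrable (fun z : ℂ => Real.exp (-(c * ‖z‖ ^ 2) + β * ‖z‖)) := by
  -- Half of the decay absorbs the linear term; completing the square gives the constant `exp (β ^ 2
  -- / (2 * c))`.
  have h := (GaussianFourier.integrable_cexp_neg_mul_sq_norm_add (V := ℂ)
    (b := ((c / 2 : ℝ) : ℂ)) (by simpa using hc) 0 0).norm
  refine (h.const_mul (Real.exp (β ^ 2 / (2 * c)))).mono'
    (Continuous.aestronglyMeasurable (by fun_prop)) (Filter.Eventually.of_forall fun z => ?_)
  rw [Real.norm_eq_abs, abs_of_pos (Real.exp_pos _), Complex.norm_exp, ← Real.exp_add]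
  refine Real.exp_le_exp.2 ?_
  have h1 : (-((c / 2 : ℝ) : ℂ) * (‖z‖ : ℂ) ^ 2 + 0 * ((inner ℝ (0 : ℂ) z : ℝ) : ℂ)).re =
      -(c / 2 * ‖z‖ ^ 2) := by
    rw [zero_mul, add_zero, ← Complex.ofReal_pow, ← Complex.ofReal_neg, ← Complex.ofReal_mul,
      Complex.ofReal_re]
    ring
  rw [h1]
  have h2 : 0 ≤ (c * ‖z‖ - β) ^ 2 / (2 * c) := by positivity
  have h3 : (c * ‖z‖ - β) ^ 2 / (2 * c) = c / 2 * ‖z‖ ^ 2 - β * ‖z‖ + β ^ 2 / (2 * c) := by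
    field_simp
    ring
  linarith

theorem integral_ofReal_exp_neg_mul_sq_norm {t : ℝ} (ht : 0 < t) :
    ∫ z : ℂ, ((Real.exp (-(t * ‖z‖ ^ 2)) : ℝ) : ℂ) = Real.pi / t := by
  rw [integral_complex_ofReal]
  have h := GaussianFourier.integral_rexp_neg_mul_sq_norm (V := ℂ) ht
  simp only [neg_mul] at h
  rw [h]
  simp

theorem integral_circleMap_mul {p : ℂ → ℂ} (hp : Differentiable ℂ p) (z : ℂ) :
    ∫ θ in (0 : ℝ)..2 * Real.pi, p (circleMap 0 1 θ * z) = 2 * Real.pi * p 0 := by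
  have hq : Differentiable ℂ fun ξ => p (ξ * z) := by fun_prop
  have h := DiffContOnCl.circleAverage (f := fun ξ => p (ξ * z)) (c := 0) (R := 1)
    hq.diffContOnCl
  rw [Real.circleAverage_def, zero_mul] at h
  rw [← h, Complex.real_smul]
  push_cast
  rw [mul_inv_cancel_left₀ (by simp [Real.pi_ne_zero])]

/-- The mean value property with respect to a Gaussian measure centred at the origin. -/
theorem integral_mul_exp_neg_mul_sq_norm {t : ℝ} (ht : 0 < t) {p : ℂ → ℂ}
    (hp : Differentiable ℂ p)
    (hi : Integrable fun z : ℂ => p z * (Real.exp (-(t * ‖z‖ ^ 2)) : ℝ)) :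
    ∫ z : ℂ, p z * (Real.exp (-(t * ‖z‖ ^ 2)) : ℝ) = Real.pi / t * p 0 := by
  set W : ℂ → ℂ := fun z => p z * (Real.exp (-(t * ‖z‖ ^ 2)) : ℝ) with hW
  have hpc := hp.continuous
  have hWc : Continuous W := by fun_prop
  -- Rotations preserve the weight and the measure, so averaging over `θ` does not change the
  -- integral; after Fubini the circle mean of `p` is `p 0`.
  have hrot : ∀ θ : ℝ, MeasurePreserving (fun z : ℂ => circleMap 0 1 θ * z) := by
    intro θ
    have hmem : circleMap 0 1 θ ∈ Submonoid.unitSphere ℂ := by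
      simp [Submonoid.unitSphere, circleMap]
    exact (rotation ⟨circleMap 0 1 θ, hmem⟩).measurePreserving
  have hemb : ∀ θ : ℝ, MeasurableEmbedding (fun z : ℂ => circleMap 0 1 θ * z) := by
    intro θ
    exact (Homeomorph.mulLeft₀ (circleMap 0 1 θ) (by simp)).measurableEmbedding
  have hnorm : ∀ (θ : ℝ) (z : ℂ), ‖circleMap 0 1 θ * z‖ = ‖z‖ := by
    intro θ z
    simp
  have hint : Integrable (fun q : ℂ × ℝ => W (circleMap 0 1 q.2 * q.1))
      (volume.prod (volume.restrict (Set.Ioc 0 (2 * Real.pi)))) := by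
    have hc : Continuous fun q : ℂ × ℝ => W (circleMap 0 1 q.2 * q.1) := by fun_prop
    rw [integrable_prod_iff' hc.aestronglyMeasurable]
    constructor
    · exact Filter.Eventually.of_forall fun θ =>
        ((hrot θ).integrable_comp_emb (hemb θ)).2 hi
    · have : ∀ θ : ℝ, ∫ z : ℂ, ‖W (circleMap 0 1 θ * z)‖ = ∫ z : ℂ, ‖W z‖ := fun θ =>
        (hrot θ).integral_comp (hemb θ) fun z => ‖W z‖
      simp only [this]
      exact integrable_const _
  have hswap := integral_integral_swap (f := fun (z : ℂ) (θ : ℝ) => W (circleMap 0 1 θ * z)) hint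
  have h1 : ∀ θ : ℝ, ∫ z : ℂ, W (circleMap 0 1 θ * z) = ∫ z : ℂ, W z := fun θ =>
    (hrot θ).integral_comp (hemb θ) W
  have h2 : ∀ z : ℂ, ∫ θ in Set.Ioc 0 (2 * Real.pi), W (circleMap 0 1 θ * z) =
      2 * Real.pi * p 0 * (Real.exp (-(t * ‖z‖ ^ 2)) : ℝ) := by
    intro z
    simp only [hW, hnorm]
    rw [integral_mul_const, ← intervalIntegral.integral_of_le (by positivity),
      integral_circleMap_mul hp]
  simp only [h1, h2] at hswap
  rw [integral_const_mul, integral_ofReal_exp_neg_mul_sq_norm ht] at hswap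
  have hpi : (Real.pi : ℂ) ≠ 0 := by exact_mod_cast Real.pi_ne_zero
  have h3 : ((2 * Real.pi : ℝ) : ℂ) * ∫ z : ℂ, W z =
      2 * Real.pi * p 0 * (Real.pi / t) := by
    rw [hswap]
    simp [Real.pi_pos.le]
  push_cast at h3
  refine mul_left_cancel₀ (mul_ne_zero two_ne_zero hpi) (h3.trans ?_)
  ring

/-- The reproducing formula for the weight `exp (-t|z|²)`. -/
theorem integral_mul_exp_mul_conj {t : ℝ} (ht : 0 < t) {p : ℂ → ℂ} (hp : Differentiable ℂ p)
    (w : ℂ) (hi : Integrable fun z : ℂ =>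
      p z * Complex.exp (t * (w * conj z)) * (Real.exp (-(t * ‖z‖ ^ 2)) : ℝ)) :
    ∫ z : ℂ, p z * Complex.exp (t * (w * conj z)) * (Real.exp (-(t * ‖z‖ ^ 2)) : ℝ) =
      Real.pi / t * p w := by
  -- Translating by `w` leaves only the holomorphic factor `exp (-(t * (z * conj w)))` beside the
  -- radial weight, and this factor is 1 at the origin.
  have key : ∀ z : ℂ, p (z + w) * Complex.exp (t * (w * conj (z + w))) *
      (Real.exp (-(t * ‖z + w‖ ^ 2)) : ℝ) =
      p (z + w) * Complex.exp (-(t * (z * conj w))) * (Real.exp (-(t * ‖z‖ ^ 2)) : ℝ) := by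
    intro z
    rw [ofReal_exp_neg_mul_sq_norm, ofReal_exp_neg_mul_sq_norm, mul_assoc, mul_assoc,
      ← Complex.exp_add, ← Complex.exp_add, map_add]
    ring_nf
  have hd : Differentiable ℂ fun z => p (z + w) * Complex.exp (-(t * (z * conj w))) := by fun_prop
  rw [← integral_add_right_eq_self _ w]
  have hi' := hi.comp_add_right w
  simp only [key] at hi' ⊢
  rw [integral_mul_exp_neg_mul_sq_norm ht hd hi']
  simp

/-! ### Pointwise growth and derivatives in the Fock space -/

/-- Growth of order two with the type of the Fock space, up to exponential factors. -/
def FockGrowth (p : ℂ → ℂ) : Prop :=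
  ∃ M α : ℝ, 0 ≤ M ∧ 0 ≤ α ∧ ∀ z, ‖p z‖ ≤ M * Real.exp (‖z‖ ^ 2 / 2 + α * ‖z‖)

theorem norm_exp_le (z : ℂ) : ‖Complex.exp z‖ ≤ Real.exp ‖z‖ := by
  rw [Complex.norm_exp]
  exact Real.exp_le_exp.2 (Complex.re_le_norm z)

theorem FockGrowth.integrable {p : ℂ → ℂ} (hp : FockGrowth p) (hc : Continuous p) {t : ℝ}
    (ht : 1 ≤ t) (m : ℕ) (β : ℝ) :
    Integrable fun z : ℂ =>
      ‖p z‖ * ‖z‖ ^ m * Real.exp (β * ‖z‖) * Real.exp (-(t * ‖z‖ ^ 2)) := by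
  obtain ⟨M, α, hM, hα, h⟩ := hp
  refine ((integrable_exp_neg_mul_sq_norm_add (c := t - 1 / 2) (by linarith)
    (α + m + β)).const_mul M).mono' (Continuous.aestronglyMeasurable (by fun_prop))
    (Filter.Eventually.of_forall fun z => ?_)
  rw [Real.norm_eq_abs, abs_of_nonneg (by positivity)]
  have h1 : ‖z‖ ^ m ≤ Real.exp (m * ‖z‖) := by
    rw [Real.exp_nat_mul]
    exact pow_le_pow_left₀ (norm_nonneg z) (by linarith [Real.add_one_le_exp ‖z‖]) m
  calc _ ≤ M * Real.exp (‖z‖ ^ 2 / 2 + α * ‖z‖) * Real.exp (m * ‖z‖) *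
        Real.exp (β * ‖z‖) * Real.exp (-(t * ‖z‖ ^ 2)) := by
        gcongr
        exact h z
    _ = _ := by
        rw [mul_assoc, mul_assoc, mul_assoc, ← Real.exp_add, ← Real.exp_add, ← Real.exp_add]
        ring_nf

theorem FockGrowth.integrable_mul_exp {p : ℂ → ℂ} (hp : FockGrowth p) (hc : Continuous p) {t : ℝ}
    (ht : 1 ≤ t) (m : ℕ) (w : ℂ) :
    Integrable fun z : ℂ => p z * conj z ^ m * Complex.exp (t * (w * conj z)) *
      (Real.exp (-(t * ‖z‖ ^ 2)) : ℝ) := by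
  refine (hp.integrable hc ht m (t * ‖w‖)).mono'
    (Continuous.aestronglyMeasurable (by fun_prop)) (Filter.Eventually.of_forall fun z => ?_)
  rw [norm_mul, norm_mul, norm_mul, norm_pow, RCLike.norm_conj, Complex.norm_real,
    Real.norm_eq_abs, abs_of_pos (Real.exp_pos _)]
  gcongr
  refine (norm_exp_le _).trans (le_of_eq ?_)
  rw [norm_mul, norm_mul, RCLike.norm_conj, Complex.norm_real, Real.norm_eq_abs,
    abs_of_nonneg (by linarith), mul_assoc]

theorem FockGrowth.integral_mul_exp_mul_conj {p : ℂ → ℂ} (hp : FockGrowth p)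
    (hd : Differentiable ℂ p) {t : ℝ} (ht : 1 ≤ t) (w : ℂ) :
    ∫ z : ℂ, p z * Complex.exp (t * (w * conj z)) * (Real.exp (-(t * ‖z‖ ^ 2)) : ℝ) =
      Real.pi / t * p w := by
  refine _root_.integral_mul_exp_mul_conj (by linarith) hd w ?_
  simpa using hp.integrable_mul_exp hd.continuous ht 0 w

/-- The reproducing formula for derivatives. -/
theorem FockGrowth.integral_mul_conj_pow_mul_exp {p : ℂ → ℂ} (hp : FockGrowth p)
    (hd : Differentiable ℂ p) (m : ℕ) (w : ℂ) :
    ∫ z : ℂ, p z * conj z ^ m * Complex.exp (w * conj z) * (Real.exp (-‖z‖ ^ 2) : ℝ) =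
      Real.pi * iteratedDeriv m p w := by
  have hpc := hd.continuous
  induction m generalizing w with
  | zero => simpa using hp.integral_mul_exp_mul_conj hd le_rfl w
  | succ m ih =>
    have hI : ∀ (k : ℕ) (x : ℂ), Integrable fun z : ℂ =>
        p z * conj z ^ k * Complex.exp (x * conj z) * (Real.exp (-‖z‖ ^ 2) : ℝ) := fun k x => by
      simpa using hp.integrable_mul_exp hpc le_rfl k x
    -- For `x` in the unit ball around `w` this bound dominates the differentiated integrand.
    have hb := hp.integrable hpc le_rfl (m + 1) (‖w‖ + 1)
    have h := (hasDerivAt_integral_of_dominated_loc_of_deriv_le (μ := (volume : Measure ℂ))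
      (F := fun x z => p z * conj z ^ m * Complex.exp (x * conj z) * (Real.exp (-‖z‖ ^ 2) : ℝ))
      (F' := fun x z =>
        p z * conj z ^ (m + 1) * Complex.exp (x * conj z) * (Real.exp (-‖z‖ ^ 2) : ℝ))
      (x₀ := w) (Metric.ball_mem_nhds w one_pos)
      (Filter.Eventually.of_forall fun x => (hI m x).aestronglyMeasurable) (hI m w)
      (hI (m + 1) w).aestronglyMeasurable
      (Filter.Eventually.of_forall fun z x hx => ?_) hb
      (Filter.Eventually.of_forall fun z x _ => ?_)).2
    · have hh : (fun x : ℂ => ∫ z : ℂ, p z * conj z ^ m * Complex.exp (x * conj z) *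
          (Real.exp (-‖z‖ ^ 2) : ℝ)) = fun x => Real.pi * iteratedDeriv m p x := funext ih
      rw [hh] at h
      rw [iteratedDeriv_succ, ← h.deriv, deriv_const_mul_field]
    · rw [norm_mul, norm_mul, norm_mul, norm_pow, RCLike.norm_conj, Complex.norm_real,
        Real.norm_eq_abs, abs_of_pos (Real.exp_pos _), one_mul]
      gcongr
      refine (norm_exp_le _).trans (Real.exp_le_exp.2 ?_)
      rw [norm_mul, RCLike.norm_conj]
      gcongr
      rw [Metric.mem_ball, dist_eq_norm] at hx
      have := norm_le_norm_add_norm_sub' x w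
      linarith
    · have h1 : HasDerivAt (fun x => Complex.exp (x * conj z))
          (Complex.exp (x * conj z) * (1 * conj z)) x :=
        ((hasDerivAt_id x).mul_const _).cexp
      convert! (h1.const_mul (p z * conj z ^ m)).mul_const ((Real.exp (-‖z‖ ^ 2) : ℝ) : ℂ) using 1
      ring

/-- Cauchy's estimate on a unit circle costs a factor `exp ‖z‖` and a constant, which the linear
term in the exponent absorbs. -/
theorem FockGrowth.iteratedDeriv {p : ℂ → ℂ} (hp : FockGrowth p) (hd : Differentiable ℂ p)
    (m : ℕ) : FockGrowth (iteratedDeriv m p) := by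
  obtain ⟨M, α, hM, hα, h⟩ := hp
  refine ⟨m.factorial * (M * Real.exp (1 / 2 + α)), α + 1, by positivity, by positivity,
    fun z => ?_⟩
  have h1 := Complex.norm_iteratedDeriv_le_of_forall_mem_sphere_norm_le (c := z) (R := 1)
    (C := M * Real.exp ((‖z‖ + 1) ^ 2 / 2 + α * (‖z‖ + 1))) m one_pos hd.diffContOnCl ?_
  · refine h1.trans (le_of_eq ?_)
    rw [one_pow, div_one, mul_assoc, mul_assoc, ← Real.exp_add]
    ring_nf
  · intro x hx
    have hx' : ‖x‖ ≤ ‖z‖ + 1 := by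
      have := norm_le_norm_add_norm_sub' x z
      rw [mem_sphere_iff_norm] at hx
      linarith
    refine (h x).trans ?_
    gcongr

theorem FockSpace.integrable_mul_exp (f : FockSpace) (w : ℂ) :
    Integrable fun z : ℂ => f z * Complex.exp (w * conj z) * (Real.exp (-‖z‖ ^ 2) : ℝ) := by
  have hc := f.differentiable.continuous
  have hg : Integrable fun z : ℂ => Real.exp (-‖z‖ ^ 2 + 2 * ‖w‖ * ‖z‖) := by
    simpa using integrable_exp_neg_mul_sq_norm_add one_pos (2 * ‖w‖)
  refine (f.integrable_sq.add hg).mono' (Continuous.aestronglyMeasurable (by fun_prop))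
    (Filter.Eventually.of_forall fun z => ?_)
  rw [norm_mul, norm_mul, Complex.norm_real, Real.norm_eq_abs, abs_of_pos (Real.exp_pos _),
    Pi.add_apply, Real.exp_add, mul_comm (Real.exp _) (Real.exp (2 * ‖w‖ * ‖z‖)), ← add_mul]
  refine mul_le_mul_of_nonneg_right ?_ (Real.exp_pos _).le
  have h1 : ‖Complex.exp (w * conj z)‖ ≤ Real.exp (‖w‖ * ‖z‖) := by
    simpa using norm_exp_le (w * conj z)
  have h2 : Real.exp (2 * ‖w‖ * ‖z‖) = Real.exp (‖w‖ * ‖z‖) ^ 2 := by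
    rw [← Real.exp_nat_mul]
    push_cast
    ring_nf
  rw [h2]
  have := mul_le_mul_of_nonneg_left h1 (norm_nonneg (f z))
  nlinarith [sq_nonneg (‖f z‖ - Real.exp (‖w‖ * ‖z‖)), sq_nonneg ‖f z‖]

/-- In the reproducing formula, `norm_exp_mul_conj` splits off `exp (‖w‖ ^ 2 / 2)`. The rest is a
product of two square-integrable factors, bounded by the sum of their squares; the second is a
translated Gaussian, whose integral does not depend on `w`. -/
theorem FockSpace.fockGrowth (f : FockSpace) : FockGrowth f := by
  have hpi := Real.pi_pos
  have hg : Integrable fun z : ℂ => Real.exp (-‖z‖ ^ 2) := by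
    simpa using integrable_exp_neg_mul_sq_norm_add one_pos 0
  set K := ∫ z : ℂ, ‖f z‖ ^ 2 * Real.exp (-‖z‖ ^ 2) with hK
  set L := ∫ z : ℂ, Real.exp (-‖z‖ ^ 2) with hL
  have hK0 : 0 ≤ K := integral_nonneg fun z => by positivity
  have hL0 : 0 ≤ L := integral_nonneg fun z => by positivity
  refine ⟨Real.pi⁻¹ * (K + L), 0, by positivity, le_rfl, fun w => ?_⟩
  have hr := integral_mul_exp_mul_conj one_pos f.differentiable w
    (by simpa using f.integrable_mul_exp w)
  simp only [Complex.ofReal_one, one_mul, div_one] at hr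
  have hfw : ‖f w‖ = Real.pi⁻¹ *
      ‖∫ z : ℂ, f z * Complex.exp (w * conj z) * (Real.exp (-‖z‖ ^ 2) : ℝ)‖ := by
    rw [hr, norm_mul, Complex.norm_real, Real.norm_eq_abs, abs_of_pos hpi]
    field_simp
  rw [hfw, mul_assoc, zero_mul, add_zero]
  refine mul_le_mul_of_nonneg_left ?_ (by positivity)
  have hLw : ∫ z : ℂ, Real.exp (-‖w - z‖ ^ 2) = L :=
    integral_sub_left_eq_self (fun z : ℂ => Real.exp (-‖z‖ ^ 2)) volume w
  have hgw : Integrable fun z : ℂ => Real.exp (-‖w - z‖ ^ 2) := hg.comp_sub_left w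
  rw [← hLw, hK, ← integral_add f.integrable_sq hgw, ← integral_mul_const]
  refine norm_integral_le_of_norm_le ((f.integrable_sq.add hgw).mul_const _)
    (Filter.Eventually.of_forall fun z => ?_)
  rw [norm_mul, norm_mul, norm_exp_mul_conj, Complex.norm_real, Real.norm_eq_abs,
    abs_of_pos (Real.exp_pos _)]
  have e1 : ‖f z‖ * Real.exp (‖w‖ ^ 2 / 2 + ‖z‖ ^ 2 / 2 - ‖w - z‖ ^ 2 / 2) *
      Real.exp (-‖z‖ ^ 2) =
      ‖f z‖ * Real.exp (-‖z‖ ^ 2 / 2) * Real.exp (-‖w - z‖ ^ 2 / 2) * Real.exp (‖w‖ ^ 2 / 2) := by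
    simp only [mul_assoc, ← Real.exp_add]
    ring_nf
  have e2 : ∀ x : ℝ, Real.exp (-x) = Real.exp (-x / 2) ^ 2 := fun x => by
    rw [← Real.exp_nat_mul]
    push_cast
    ring_nf
  rw [e1, e2 (‖z‖ ^ 2), e2 (‖w - z‖ ^ 2), ← mul_pow]
  refine mul_le_mul_of_nonneg_right ?_ (Real.exp_pos _).le
  set a := ‖f z‖ * Real.exp (-‖z‖ ^ 2 / 2)
  set b := Real.exp (-‖w - z‖ ^ 2 / 2)
  nlinarith [sq_nonneg (a - b), sq_nonneg a, sq_nonneg b]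

/-! ### Division by a power of the variable; adjointness of differentiation -/

section Quotient

variable {F : FockSpace} {h : ℂ → ℂ} {m : ℕ}

theorem fockGrowth_of_eq_pow_mul (hh : Continuous h) (hF : ∀ z, F z = z ^ m * h z) :
    FockGrowth h := by
  obtain ⟨M, α, hM, hα, hb⟩ := F.fockGrowth
  obtain ⟨N, hN⟩ := (isCompact_closedBall (0 : ℂ) 1).exists_bound_of_continuousOn hh.continuousOn
  have hN0 : 0 ≤ N := (norm_nonneg _).trans (hN 0 (by simp))
  refine ⟨M + N, α, by positivity, hα, fun z => ?_⟩
  rcases le_total ‖z‖ 1 with hz | hz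
  · refine (hN z (by simpa using hz)).trans ?_
    have h1 : 1 ≤ Real.exp (‖z‖ ^ 2 / 2 + α * ‖z‖) := Real.one_le_exp (by positivity)
    nlinarith
  · have h1 := hb z
    rw [hF, norm_mul, norm_pow] at h1
    have h2 : 1 ≤ ‖z‖ ^ m := one_le_pow₀ hz
    have h3 := Real.exp_pos (‖z‖ ^ 2 / 2 + α * ‖z‖)
    have h4 := norm_nonneg (h z)
    nlinarith [mul_nonneg hN0 h3.le, mul_nonneg (sub_nonneg.2 h2) h4]

theorem integrable_sq_mul_one_add_norm_pow (hh : Continuous h) (hF : ∀ z, F z = z ^ m * h z) :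
    Integrable fun z : ℂ => ‖h z‖ ^ 2 * (1 + ‖z‖) ^ (2 * m) * Real.exp (-‖z‖ ^ 2) := by
  have hg : Integrable fun z : ℂ => Real.exp (-‖z‖ ^ 2) := by
    simpa using integrable_exp_neg_mul_sq_norm_add one_pos 0
  have hc : Continuous fun z => ‖h z‖ ^ 2 * (1 + ‖z‖) ^ (2 * m) := by fun_prop
  obtain ⟨N, hN⟩ := (isCompact_closedBall (0 : ℂ) 1).exists_bound_of_continuousOn hc.continuousOn
  have hN0 : 0 ≤ N := (norm_nonneg _).trans (hN 0 (by simp))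
  refine ((F.integrable_sq.const_mul (4 ^ m)).add (hg.const_mul N)).mono'
    (Continuous.aestronglyMeasurable (by fun_prop)) (Filter.Eventually.of_forall fun z => ?_)
  rw [Real.norm_eq_abs, abs_of_nonneg (by positivity), Pi.add_apply, ← mul_assoc, ← add_mul]
  refine mul_le_mul_of_nonneg_right ?_ (Real.exp_pos _).le
  rcases le_total ‖z‖ 1 with hz | hz
  · have h1 := hN z (by simpa using hz)
    rw [Real.norm_eq_abs, abs_of_nonneg (by positivity)] at h1
    have : 0 ≤ 4 ^ m * ‖F z‖ ^ 2 := by positivity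
    linarith
  · have h1 : (1 + ‖z‖) ^ (2 * m) ≤ (2 * ‖z‖) ^ (2 * m) := by
      gcongr
      linarith
    have h2 : (2 * ‖z‖) ^ (2 * m) = 4 ^ m * (‖z‖ ^ m) ^ 2 := by
      rw [mul_pow, pow_mul, pow_mul, pow_right_comm ‖z‖]
      norm_num
    rw [hF, norm_mul, norm_pow]
    rw [h2] at h1
    nlinarith [mul_le_mul_of_nonneg_left h1 (sq_nonneg ‖h z‖)]

/-- The Gaussian weights and the kernel combine to a Gaussian in `z - ζ`. Up to a power of `1 + ‖z -
ζ‖`, the factor `‖ζ‖ ^ m` can be moved to `z`, where `h` absorbs it because `z ^ m * h z` is in the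
Fock space. Two convolution integrands then dominate. Neither `h` nor the `m`-th derivative of `b`
is estimated alone: the latter need not be in the Fock space. -/
theorem integrable_prod_conj_mul_mul_exp (hh : Continuous h) (hF : ∀ z, F z = z ^ m * h z)
    (b : FockSpace) :
    Integrable (fun q : ℂ × ℂ => conj (h q.1) * (b q.2 * conj q.2 ^ m *
      Complex.exp (q.1 * conj q.2) * (Real.exp (-‖q.2‖ ^ 2) : ℝ)) * (Real.exp (-‖q.1‖ ^ 2) : ℝ))
      (volume.prod volume) := by
  have hbc := b.differentiable.continuous
  set κ : ℂ → ℝ := fun d => (1 + ‖d‖) ^ m * Real.exp (-‖d‖ ^ 2 / 2) with hκ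
  have hκi : Integrable κ := by
    refine (integrable_exp_neg_mul_sq_norm_add (c := 1 / 2) (by norm_num) m).mono'
      (Continuous.aestronglyMeasurable (by fun_prop)) (Filter.Eventually.of_forall fun z => ?_)
    rw [Real.norm_eq_abs, abs_of_nonneg (by positivity), Real.exp_add, Real.exp_nat_mul, mul_comm]
    have : 1 + ‖z‖ ≤ Real.exp ‖z‖ := by linarith [Real.add_one_le_exp ‖z‖]
    have e : -(1 / 2 * ‖z‖ ^ 2) = -‖z‖ ^ 2 / 2 := by ring
    rw [e]
    change (1 + ‖z‖) ^ m * Real.exp (-‖z‖ ^ 2 / 2) ≤ _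
    gcongr
  set a : ℂ → ℝ := fun z => ‖h z‖ ^ 2 * (1 + ‖z‖) ^ (2 * m) * Real.exp (-‖z‖ ^ 2) with ha
  set β : ℂ → ℝ := fun z => ‖b z‖ ^ 2 * Real.exp (-‖z‖ ^ 2) with hβ
  have hai : Integrable a := integrable_sq_mul_one_add_norm_pow hh hF
  have hβi : Integrable β := b.integrable_sq
  have i1 : Integrable (fun q : ℂ × ℂ => β q.2 * κ (q.1 - q.2)) (volume.prod volume) :=
    hβi.convolution_integrand (ContinuousLinearMap.mul ℝ ℝ) hκi
  have i2 : Integrable (fun q : ℂ × ℂ => a q.1 * κ (q.2 - q.1)) (volume.prod volume) :=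
    (hai.convolution_integrand (ContinuousLinearMap.mul ℝ ℝ) hκi).swap
  refine (i1.add i2).mono' (Continuous.aestronglyMeasurable (by fun_prop))
    (Filter.Eventually.of_forall ?_)
  rintro ⟨z, ζ⟩
  simp only [Pi.add_apply, norm_mul, norm_pow, RCLike.norm_conj, norm_exp_mul_conj,
    Complex.norm_real, Real.norm_eq_abs, Real.abs_exp]
  have hκs : κ (ζ - z) = κ (z - ζ) := by simp only [hκ, norm_sub_rev]
  rw [hκs, ← add_mul]
  have e2 : ∀ x : ℝ, Real.exp (-x) = Real.exp (-x / 2) ^ 2 := fun x => by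
    rw [← Real.exp_nat_mul]
    push_cast
    ring_nf
  have h1 : ‖ζ‖ ^ m ≤ (1 + ‖z‖) ^ m * (1 + ‖z - ζ‖) ^ m := by
    rw [← mul_pow]
    gcongr
    have := norm_le_norm_add_norm_sub z ζ
    nlinarith [norm_nonneg z, norm_nonneg (z - ζ)]
  set x := ‖h z‖ * (1 + ‖z‖) ^ m * Real.exp (-‖z‖ ^ 2 / 2) with hx
  set y := ‖b ζ‖ * Real.exp (-‖ζ‖ ^ 2 / 2) with hy
  have hax : a z = x ^ 2 := by
    simp only [ha, hx]
    rw [e2, mul_pow, mul_pow, ← pow_mul, mul_comm m 2]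
  have hby : β ζ = y ^ 2 := by
    simp only [hβ, hy]
    rw [e2, mul_pow]
  have hκ0 : 0 ≤ κ (z - ζ) := by positivity
  have hxy : x * y ≤ β ζ + a z := by
    rw [hax, hby]
    nlinarith [sq_nonneg (x - y), sq_nonneg x, sq_nonneg y]
  refine le_trans ?_ (mul_le_mul_of_nonneg_right hxy hκ0)
  have e3 : Real.exp (‖z‖ ^ 2 / 2 + ‖ζ‖ ^ 2 / 2 - ‖z - ζ‖ ^ 2 / 2) * Real.exp (-‖ζ‖ ^ 2) *
      Real.exp (-‖z‖ ^ 2) = Real.exp (-‖z‖ ^ 2 / 2) * Real.exp (-‖ζ‖ ^ 2 / 2) *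
      Real.exp (-‖z - ζ‖ ^ 2 / 2) := by
    simp only [← Real.exp_add]
    ring_nf
  calc _ = ‖h z‖ * ‖b ζ‖ * ‖ζ‖ ^ m *
        (Real.exp (‖z‖ ^ 2 / 2 + ‖ζ‖ ^ 2 / 2 - ‖z - ζ‖ ^ 2 / 2) * Real.exp (-‖ζ‖ ^ 2) *
          Real.exp (-‖z‖ ^ 2)) := by ring
    _ ≤ ‖h z‖ * ‖b ζ‖ * ((1 + ‖z‖) ^ m * (1 + ‖z - ζ‖) ^ m) *
        (Real.exp (-‖z‖ ^ 2 / 2) * Real.exp (-‖ζ‖ ^ 2 / 2) * Real.exp (-‖z - ζ‖ ^ 2 / 2)) := by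
      rw [e3]
      gcongr
    _ = _ := by
      simp only [hx, hy, hκ]
      ring

theorem integrable_conj_mul_iteratedDeriv (hh : Continuous h) (hF : ∀ z, F z = z ^ m * h z)
    (b : FockSpace) :
    Integrable fun z : ℂ => conj (h z) * iteratedDeriv m b z * (Real.exp (-‖z‖ ^ 2) : ℝ) := by
  have hi := (integrable_prod_conj_mul_mul_exp hh hF b).integral_prod_left
  simp only [integral_mul_const, integral_const_mul,
    b.fockGrowth.integral_mul_conj_pow_mul_exp b.differentiable] at hi
  refine (hi.const_mul (Real.pi : ℂ)⁻¹).congr (Filter.Eventually.of_forall fun z => ?_)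
  have hpi : (Real.pi : ℂ) ≠ 0 := by exact_mod_cast Real.pi_ne_zero
  simp only
  field_simp

/-- On the Fock space, differentiation and multiplication by the variable are adjoint. -/
theorem integral_conj_mul_iteratedDeriv (hh : Differentiable ℂ h) (hF : ∀ z, F z = z ^ m * h z)
    (b : FockSpace) :
    ∫ z : ℂ, conj (h z) * iteratedDeriv m b z * (Real.exp (-‖z‖ ^ 2) : ℝ) =
      ∫ z : ℂ, conj (F z) * b z * (Real.exp (-‖z‖ ^ 2) : ℝ) := by
  have hi := integrable_prod_conj_mul_mul_exp hh.continuous hF b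
  -- Integrating first over `ζ` reproduces the derivative of `b`; integrating first over `z`
  -- reproduces `h ζ`, which the factor `conj ζ ^ m` completes to `conj (F ζ)`.
  have hs := integral_integral_swap (f := fun z ζ : ℂ => conj (h z) * (b ζ * conj ζ ^ m *
      Complex.exp (z * conj ζ) * (Real.exp (-‖ζ‖ ^ 2) : ℝ)) * (Real.exp (-‖z‖ ^ 2) : ℝ)) hi
  have hin : ∀ ζ : ℂ, ∫ z : ℂ, conj (h z) * (b ζ * conj ζ ^ m *
      Complex.exp (z * conj ζ) * (Real.exp (-‖ζ‖ ^ 2) : ℝ)) * (Real.exp (-‖z‖ ^ 2) : ℝ) =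
      Real.pi * (conj (F ζ) * b ζ * (Real.exp (-‖ζ‖ ^ 2) : ℝ)) := by
    intro ζ
    have hr := (fockGrowth_of_eq_pow_mul hh.continuous hF).integral_mul_exp_mul_conj hh le_rfl ζ
    have hr' := congrArg conj hr
    rw [← integral_conj] at hr'
    simp only [map_mul, ← Complex.exp_conj, Complex.conj_conj, Complex.conj_ofReal,
      Complex.ofReal_one, one_mul, div_one] at hr'
    rw [hF, map_mul, map_pow]
    calc _ = ∫ z : ℂ, b ζ * conj ζ ^ m * (Real.exp (-‖ζ‖ ^ 2) : ℝ) *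
          (conj (h z) * Complex.exp (conj ζ * z) * (Real.exp (-‖z‖ ^ 2) : ℝ)) := by
          congr 1
          ext z
          rw [mul_comm (conj ζ) z]
          ring
      _ = _ := by
          rw [integral_const_mul, hr']
          ring
  simp only [hin, integral_mul_const, integral_const_mul,
    b.fockGrowth.integral_mul_conj_pow_mul_exp b.differentiable] at hs
  have hpi : (Real.pi : ℂ) ≠ 0 := by exact_mod_cast Real.pi_ne_zero
  refine mul_left_cancel₀ hpi (Eq.trans ?_ hs)
  rw [← integral_const_mul]
  congr 1
  ext z
  ring

end Quotient

/-! ### Symmetry of weighted composition with an affine map -/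

theorem tendsto_integral_mul_exp_mul_exp (B : ℂ) {G : ℂ → ℂ} (hG : Integrable G) :
    Filter.Tendsto (fun s : ℝ => ∫ u : ℂ, G u *
      (Complex.exp (s * (u * conj B)) * (Real.exp (-(s * ‖u‖ ^ 2)) : ℝ)))
      (nhdsWithin 0 (Set.Ioi 0)) (nhds (∫ u : ℂ, G u)) := by
  -- For `0 < s < 1` the exponent is at most `s * (‖u‖ * ‖B‖ - ‖u‖ ^ 2) ≤ ‖B‖ ^ 2`.
  refine tendsto_integral_filter_of_dominated_convergence
    (fun u => ‖G u‖ * Real.exp (‖B‖ ^ 2)) ?_ ?_ (hG.norm.mul_const _) ?_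
  · exact Filter.Eventually.of_forall fun s => hG.aestronglyMeasurable.mul
      (Continuous.aestronglyMeasurable (by fun_prop))
  · have h1 : ∀ᶠ s : ℝ in nhdsWithin 0 (Set.Ioi 0), s < 1 :=
      nhdsWithin_le_nhds (eventually_lt_nhds one_pos)
    filter_upwards [self_mem_nhdsWithin, h1] with s hs hs1
    have hs0 : 0 < s := hs
    refine Filter.Eventually.of_forall fun u => ?_
    rw [norm_mul, norm_mul, Complex.norm_real, Real.norm_eq_abs, Real.abs_exp]
    gcongr
    refine (mul_le_mul_of_nonneg_right (norm_exp_le _) (Real.exp_pos _).le).trans ?_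
    rw [← Real.exp_add, norm_mul, norm_mul, RCLike.norm_conj, Complex.norm_real, Real.norm_eq_abs,
      abs_of_pos hs0]
    refine Real.exp_le_exp.2 ?_
    nlinarith [mul_nonneg hs0.le (sq_nonneg (‖u‖ - ‖B‖ / 2)), sq_nonneg ‖B‖,
      mul_nonneg (sub_nonneg.2 hs1.le) (sq_nonneg ‖B‖)]
  · refine Filter.Eventually.of_forall fun u => ?_
    have hc : Continuous fun s : ℝ => G u *
        (Complex.exp (s * (u * conj B)) * (Real.exp (-(s * ‖u‖ ^ 2)) : ℝ)) := by fun_prop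
    have := (hc.tendsto 0).mono_left (nhdsWithin_le_nhds (s := Set.Ioi 0))
    simpa using this

section WeightedComposition

variable {P Q : ℂ → ℂ} {A : ℝ} {B : ℂ}

/-- As `|A| ≤ 1`, the quadratic cross term is at most `t * ‖u‖ * ‖ζ‖ ≤ t * (‖u‖ ^ 2 + ‖ζ‖ ^ 2) / 2`.
With the growth of `P` and `Q` this leaves the decay rate `t - t / 2 - 1 / 2 = (t - 1) / 2` in each
variable, positive only for `t > 1`. -/
theorem integrable_prod_weightedComposition (hP : FockGrowth P) (hPc : Continuous P)
    (hQ : FockGrowth Q) (hQc : Continuous Q) (hA : |A| ≤ 1) {t : ℝ} (ht : 1 < t) :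
    Integrable (fun q : ℂ × ℂ => conj (P q.1) * (Complex.exp (t * (q.1 * conj B)) *
      (Q q.2 * Complex.exp (t * ((A * q.1 + B) * conj q.2)) *
        (Real.exp (-(t * ‖q.2‖ ^ 2)) : ℝ))) * (Real.exp (-(t * ‖q.1‖ ^ 2)) : ℝ))
      (volume.prod volume) := by
  obtain ⟨M, α, hM, hα, hP⟩ := hP
  obtain ⟨N, β, hN, hβ, hQ⟩ := hQ
  have ht0 : 0 < t := by linarith
  have hc : 0 < (t - 1) / 2 := by linarith
  have hi := (((integrable_exp_neg_mul_sq_norm_add hc (α + t * ‖B‖)).const_mul M).mul_prod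
    ((integrable_exp_neg_mul_sq_norm_add hc (β + t * ‖B‖)).const_mul N))
  refine hi.mono' (Continuous.aestronglyMeasurable (by fun_prop)) (Filter.Eventually.of_forall ?_)
  rintro ⟨u, ζ⟩
  simp only [norm_mul, RCLike.norm_conj, Complex.norm_real, Real.norm_eq_abs, Real.abs_exp]
  have b1 : ‖Complex.exp (t * (u * conj B))‖ ≤ Real.exp (t * (‖u‖ * ‖B‖)) := by
    refine (norm_exp_le _).trans (le_of_eq ?_)
    simp [abs_of_pos ht0]
  have b2 : ‖Complex.exp (t * ((A * u + B) * conj ζ))‖ ≤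
      Real.exp (t * ((‖u‖ + ‖B‖) * ‖ζ‖)) := by
    refine (norm_exp_le _).trans (Real.exp_le_exp.2 ?_)
    rw [norm_mul, norm_mul, RCLike.norm_conj, Complex.norm_real, Real.norm_eq_abs, abs_of_pos ht0]
    gcongr
    refine (norm_add_le _ _).trans ?_
    gcongr
    rw [norm_mul, Complex.norm_real, Real.norm_eq_abs]
    exact mul_le_of_le_one_left (norm_nonneg _) hA
  calc _ ≤ M * Real.exp (‖u‖ ^ 2 / 2 + α * ‖u‖) * (Real.exp (t * (‖u‖ * ‖B‖)) *
        (N * Real.exp (‖ζ‖ ^ 2 / 2 + β * ‖ζ‖) * Real.exp (t * ((‖u‖ + ‖B‖) * ‖ζ‖)) *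
          Real.exp (-(t * ‖ζ‖ ^ 2)))) * Real.exp (-(t * ‖u‖ ^ 2)) := by
        gcongr
        · exact hP u
        · exact hQ ζ
    _ = M * N * (Real.exp (‖u‖ ^ 2 / 2 + α * ‖u‖) * Real.exp (t * (‖u‖ * ‖B‖)) *
        Real.exp (‖ζ‖ ^ 2 / 2 + β * ‖ζ‖) * Real.exp (t * ((‖u‖ + ‖B‖) * ‖ζ‖)) *
          Real.exp (-(t * ‖ζ‖ ^ 2)) * Real.exp (-(t * ‖u‖ ^ 2))) := by ring
    _ ≤ M * N * (Real.exp (-((t - 1) / 2 * ‖u‖ ^ 2) + (α + t * ‖B‖) * ‖u‖) *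
        Real.exp (-((t - 1) / 2 * ‖ζ‖ ^ 2) + (β + t * ‖B‖) * ‖ζ‖)) := by
        simp only [← Real.exp_add]
        refine mul_le_mul_of_nonneg_left (Real.exp_le_exp.2 ?_) (by positivity)
        nlinarith [mul_nonneg ht0.le (sq_nonneg (‖u‖ - ‖ζ‖))]
    _ = _ := by ring

/-- Once `Q (A * u + B)` is written by the reproducing formula, the operator has the kernel `exp (t
* (u * conj B + A * u * conj ζ + B * conj ζ))`, which is hermitian in `(u, ζ)` because `A` is real.
-/
theorem integral_conj_mul_weightedComposition_of_one_lt (hP : FockGrowth P)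
    (hPd : Differentiable ℂ P) (hQ : FockGrowth Q) (hQd : Differentiable ℂ Q) (hA : |A| ≤ 1)
    {t : ℝ} (ht : 1 < t) :
    ∫ u : ℂ, conj (P u) * (Complex.exp (t * (u * conj B)) * Q (A * u + B)) *
        (Real.exp (-(t * ‖u‖ ^ 2)) : ℝ) =
      ∫ u : ℂ, conj (Complex.exp (t * (u * conj B)) * P (A * u + B)) * Q u *
        (Real.exp (-(t * ‖u‖ ^ 2)) : ℝ) := by
  have hs := integral_integral_swap (f := fun u ζ : ℂ => conj (P u) *
    (Complex.exp (t * (u * conj B)) * (Q ζ * Complex.exp (t * ((A * u + B) * conj ζ)) *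
        (Real.exp (-(t * ‖ζ‖ ^ 2)) : ℝ))) * (Real.exp (-(t * ‖u‖ ^ 2)) : ℝ))
    (integrable_prod_weightedComposition hP hPd.continuous hQ hQd.continuous hA ht)
  have hin : ∀ ζ : ℂ, ∫ u : ℂ, conj (P u) *
      (Complex.exp (t * (u * conj B)) * (Q ζ * Complex.exp (t * ((A * u + B) * conj ζ)) *
        (Real.exp (-(t * ‖ζ‖ ^ 2)) : ℝ))) * (Real.exp (-(t * ‖u‖ ^ 2)) : ℝ) =
      Real.pi / t * (conj (Complex.exp (t * (ζ * conj B)) * P (A * ζ + B)) * Q ζ *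
        (Real.exp (-(t * ‖ζ‖ ^ 2)) : ℝ)) := by
    intro ζ
    have hr := congrArg conj (hP.integral_mul_exp_mul_conj hPd ht.le (A * ζ + B))
    rw [← integral_conj] at hr
    simp only [map_mul, map_add, map_div₀, ← Complex.exp_conj, Complex.conj_conj,
      Complex.conj_ofReal] at hr ⊢
    calc _ = ∫ u : ℂ, Q ζ * Complex.exp (t * (conj ζ * B)) * (Real.exp (-(t * ‖ζ‖ ^ 2)) : ℝ) *
          (conj (P u) * Complex.exp (t * ((A * conj ζ + conj B) * u)) *
            (Real.exp (-(t * ‖u‖ ^ 2)) : ℝ)) := by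
          congr 1
          ext u
          have e : Complex.exp (t * (u * conj B)) * Complex.exp (t * ((A * u + B) * conj ζ)) =
              Complex.exp (t * (conj ζ * B)) *
                Complex.exp (t * ((A * conj ζ + conj B) * u)) := by
            rw [← Complex.exp_add, ← Complex.exp_add]
            ring_nf
          linear_combination (conj (P u) * Q ζ * (Real.exp (-(t * ‖ζ‖ ^ 2)) : ℝ) *
            (Real.exp (-(t * ‖u‖ ^ 2)) : ℝ)) * e
      _ = _ := by
          rw [integral_const_mul, hr]
          ring
  simp only [hin, integral_mul_const, integral_const_mul,
    hQ.integral_mul_exp_mul_conj hQd ht.le] at hs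
  have hc : (Real.pi : ℂ) / t ≠ 0 :=
    div_ne_zero (by exact_mod_cast Real.pi_ne_zero) (by exact_mod_cast (by linarith : t ≠ 0))
  refine mul_left_cancel₀ hc (Eq.trans ?_ hs)
  rw [← integral_const_mul]
  congr 1
  ext z
  ring

/-- The weighted composition operator `Q ↦ exp (u * conj B) * Q (A * u + B)` is formally
self-adjoint with respect to the Gaussian weight. -/
theorem integral_conj_mul_weightedComposition (hP : FockGrowth P) (hPd : Differentiable ℂ P)
    (hQ : FockGrowth Q) (hQd : Differentiable ℂ Q) (hA : |A| ≤ 1)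
    (h1 : Integrable fun u : ℂ => conj (P u) * (Complex.exp (u * conj B) * Q (A * u + B)) *
      (Real.exp (-‖u‖ ^ 2) : ℝ))
    (h2 : Integrable fun u : ℂ => conj (Q u) * (Complex.exp (u * conj B) * P (A * u + B)) *
      (Real.exp (-‖u‖ ^ 2) : ℝ)) :
    ∫ u : ℂ, conj (P u) * (Complex.exp (u * conj B) * Q (A * u + B)) *
        (Real.exp (-‖u‖ ^ 2) : ℝ) =
      conj (∫ u : ℂ, conj (Q u) * (Complex.exp (u * conj B) * P (A * u + B)) *
        (Real.exp (-‖u‖ ^ 2) : ℝ)) := by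
  -- Both integrals are limits, as `s → 0+`, of their analogues at `t = 1 + s`, where the identity
  -- is known.
  have l1 := tendsto_integral_mul_exp_mul_exp B h1
  have l2 := (Complex.continuous_conj.tendsto _).comp (tendsto_integral_mul_exp_mul_exp B h2)
  refine tendsto_nhds_unique (l1.congr' ?_) l2
  filter_upwards [self_mem_nhdsWithin] with s hs
  have hs0 : 0 < s := hs
  have ht := integral_conj_mul_weightedComposition_of_one_lt (B := B) hP hPd hQ hQd hA
    (t := 1 + s) (by linarith)
  have ew : ∀ u : ℂ, ((Real.exp (-((1 + s) * ‖u‖ ^ 2)) : ℝ) : ℂ) =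
      (Real.exp (-‖u‖ ^ 2) : ℝ) * (Real.exp (-(s * ‖u‖ ^ 2)) : ℝ) := fun u => by
    rw [← Complex.ofReal_mul, ← Real.exp_add]
    ring_nf
  have ee : ∀ u : ℂ, Complex.exp (((1 + s : ℝ) : ℂ) * (u * conj B)) =
      Complex.exp (u * conj B) * Complex.exp (s * (u * conj B)) := fun u => by
    rw [← Complex.exp_add]
    push_cast
    ring_nf
  simp only [ew, ee] at ht
  rw [Function.comp_apply, ← integral_conj]
  refine Eq.trans ?_ (ht.trans ?_)
  · congr 1
    ext u
    ring
  · congr 1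
    ext u
    simp only [map_mul, Complex.conj_conj, Complex.conj_ofReal]
    ring

end WeightedComposition

/-! ### Solving the functional equation of the symbols -/

theorem dense_setOf_ne_zero {p : ℂ → ℂ} (hp : Differentiable ℂ p) (h0 : ∃ z, p z ≠ 0) :
    Dense {z | p z ≠ 0} := by
  have hdiff : AnalyticOnNhd ℂ p Set.univ := fun z _ => hp.analyticAt z
  obtain ⟨w, hw⟩ := h0
  rw [← Set.compl_ofPred, ← interior_eq_empty_iff_dense_compl, Set.eq_empty_iff_forall_notMem]
  intro z hz
  have hev : p =ᶠ[nhds z] 0 := by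
    filter_upwards [mem_interior_iff_mem_nhds.1 hz] with x hx
    exact hx
  exact hw (hdiff.eqOn_zero_of_preconnected_of_eventuallyEq_zero isPreconnected_univ
    (Set.mem_univ z) hev (Set.mem_univ w))

theorem exists_affine_of_exp_eq_const {p : ℂ → ℂ} (hp : Differentiable ℂ p) {a b k : ℂ}
    (hb : b ≠ 0) (h : ∀ u, Complex.exp (u * a - p u * b) = k) :
    ∀ u, p u = a / b * u + p 0 := by
  have hd : Differentiable ℂ fun u => p u - a / b * u := by fun_prop
  have hderiv : ∀ u, deriv (fun u => p u - a / b * u) u = 0 := by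
    intro u
    have h1 : HasDerivAt (fun u => Complex.exp (u * a - p u * b))
        (Complex.exp (u * a - p u * b) * (1 * a - deriv p u * b)) u :=
      (((hasDerivAt_id u).mul_const a).sub ((hp u).hasDerivAt.mul_const b)).cexp
    have h2 : HasDerivAt (fun u => Complex.exp (u * a - p u * b)) 0 u := by
      simp only [h]
      exact hasDerivAt_const u k
    have h3 := (mul_eq_zero.1 (h1.unique h2)).resolve_left (Complex.exp_ne_zero _)
    have h4 : HasDerivAt (fun u => p u - a / b * u) (deriv p u - a / b * 1) u :=
      (hp u).hasDerivAt.sub ((hasDerivAt_id u).const_mul _)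
    rw [h4.deriv]
    field_simp
    linear_combination -h3
  intro u
  have h5 := is_const_of_deriv_eq_zero hd hderiv u 0
  linear_combination h5

/-- The functional equation satisfied by the symbols of a hermitian operator determines them. -/
theorem symbols_of_functional_equation {m : ℕ} {θ p : ℂ → ℂ} (hθ : Differentiable ℂ θ)
    (hp : Differentiable ℂ p) (hθ0 : ∃ z, θ z ≠ 0) (hp0 : 1 ≤ m → ¬ ∃ c : ℂ, ∀ z, p z = c)
    (h : ∀ z u, conj (θ z) * p u ^ m * Complex.exp (p u * conj z) =
      θ u * conj (p z) ^ m * Complex.exp (u * conj (p z))) :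
    ∃ (A C : ℝ) (B : ℂ), C ≠ 0 ∧ (∀ u, p u = A * u + B) ∧
      ∀ u, C * Complex.exp (u * conj B) * θ u = (A * u + B) ^ m := by
  have hpm : Differentiable ℂ fun u => p u ^ m := hp.pow m
  have hpm0 : ∃ z, p z ^ m ≠ 0 := by
    rcases Nat.eq_zero_or_pos m with rfl | hm
    · exact ⟨0, by simp⟩
    · by_contra! hc
      exact hp0 hm ⟨0, fun z => pow_eq_zero_iff hm.ne' |>.1 (hc z)⟩
  have hprod0 : ∃ z, θ z * p z ^ m ≠ 0 := by
    obtain ⟨z, hz, hz'⟩ := (dense_setOf_ne_zero hpm hpm0).exists_mem_open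
      (hθ.continuous.isOpen_preimage _ isOpen_compl_singleton) hθ0
    exact ⟨z, mul_ne_zero hz' hz⟩
  have hdense := dense_setOf_ne_zero (hθ.mul hpm) hprod0
  obtain ⟨z₀, hz₀⟩ := hprod0
  obtain ⟨z₁, hz₁, hne⟩ : ∃ z₁, θ z₁ * p z₁ ^ m ≠ 0 ∧ z₁ ≠ z₀ := by
    obtain ⟨z, hz, hz'⟩ := hdense.exists_mem_open (isOpen_compl_singleton (x := z₀))
      ⟨z₀ + 1, by simp⟩
    exact ⟨z, hz, hz'⟩
  have hconj : ∀ {x : ℂ}, x ≠ 0 → conj x ≠ 0 := fun hx => by simpa using hx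
  obtain ⟨hθz₀, hpz₀⟩ := mul_ne_zero_iff.1 hz₀
  obtain ⟨hθz₁, hpz₁⟩ := mul_ne_zero_iff.1 hz₁
  have hpz₀' : conj (p z₀) ^ m ≠ 0 := by rw [← map_pow]; exact hconj hpz₀
  have hpz₁' : conj (p z₁) ^ m ≠ 0 := by rw [← map_pow]; exact hconj hpz₁
  -- Dividing the equations at `z₀` and `z₁` cancels `θ u` and `p u ^ m` where they do not vanish;
  -- continuity extends the result to all `u`.
  have hexp : ∀ u, Complex.exp (u * conj (p z₁ - p z₀) - p u * conj (z₁ - z₀)) =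
      conj (θ z₁) * conj (p z₀) ^ m / (conj (θ z₀) * conj (p z₁) ^ m) := by
    have hpc := hp.continuous
    have hθc := hθ.continuous
    have hc : Continuous fun u =>
        Complex.exp (u * conj (p z₁ - p z₀) - p u * conj (z₁ - z₀)) := by fun_prop
    refine fun u => congrFun (hc.ext_on hdense continuous_const ?_) u
    intro u hu
    obtain ⟨hθu, hpu⟩ := mul_ne_zero_iff.1 (show θ u * p u ^ m ≠ 0 from hu)
    have e0 := h z₀ u
    have e1 := h z₁ u
    beta_reduce
    rw [eq_div_iff (mul_ne_zero (hconj hθz₀) hpz₁'), map_sub, map_sub, mul_sub, mul_sub,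
      Complex.exp_sub, Complex.exp_sub, Complex.exp_sub]
    have n0 := Complex.exp_ne_zero (u * conj (p z₀))
    have n1 := Complex.exp_ne_zero (p u * conj z₁)
    have n2 := Complex.exp_ne_zero (p u * conj z₀)
    field_simp
    refine mul_left_cancel₀ (mul_ne_zero hθu hpu) ?_
    linear_combination (conj (θ z₁) * p u ^ m * Complex.exp (p u * conj z₁)) * e0 -
      (conj (θ z₀) * p u ^ m * Complex.exp (p u * conj z₀)) * e1
  have hb : conj (z₁ - z₀) ≠ 0 := hconj (sub_ne_zero.2 hne)
  have haff := exists_affine_of_exp_eq_const hp hb hexp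
  set a := conj (p z₁ - p z₀) / conj (z₁ - z₀) with ha
  set B := p 0 with hB
  -- The slope is the conjugate of a difference quotient of `p`, and the affine formula equates it
  -- with that quotient itself.
  have hareal : conj a = a := by
    have e : p z₁ - p z₀ = a * (z₁ - z₀) := by
      rw [haff z₁, haff z₀]
      ring
    have e' := congrArg conj e
    rw [map_mul] at e'
    rw [ha, eq_div_iff hb, ← ha, ← e']
  obtain ⟨A, hA⟩ := Complex.conj_eq_iff_real.1 hareal
  rw [hA] at haff
  set c := conj (θ z₀) * Complex.exp (B * conj z₀) / conj (p z₀) ^ m with hc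
  have hc0 : c ≠ 0 := div_ne_zero (mul_ne_zero (hconj hθz₀) (Complex.exp_ne_zero _)) hpz₀'
  have hθc : ∀ u, Complex.exp (u * conj B) * θ u = c * p u ^ m := by
    intro u
    have e0 := h z₀ u
    have e1 : Complex.exp (p u * conj z₀) =
        Complex.exp (A * u * conj z₀) * Complex.exp (B * conj z₀) := by
      rw [← Complex.exp_add, haff u]
      ring_nf
    have e2 : Complex.exp (u * conj (p z₀)) =
        Complex.exp (A * u * conj z₀) * Complex.exp (u * conj B) := by
      rw [← Complex.exp_add, haff z₀, map_add, map_mul, Complex.conj_ofReal]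
      ring_nf
    rw [e1, e2] at e0
    rw [hc, div_mul_eq_mul_div, eq_div_iff hpz₀']
    refine mul_left_cancel₀ (Complex.exp_ne_zero (A * u * conj z₀)) ?_
    linear_combination -e0
  -- The diagonal case `z = u = z₀` of the equation gives the reality of the constant.
  have hcreal : conj c = c := by
    have e0 := h z₀ z₀
    have e1 := hθc z₀
    have e1' := congrArg conj e1
    rw [map_mul, map_mul, map_pow, ← Complex.exp_conj, map_mul, Complex.conj_conj] at e1'
    have e2 : Complex.exp (p z₀ * conj z₀) =
        Complex.exp (A * z₀ * conj z₀) * Complex.exp (conj z₀ * B) := by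
      rw [← Complex.exp_add, haff z₀]
      ring_nf
    have e3 : Complex.exp (z₀ * conj (p z₀)) =
        Complex.exp (A * z₀ * conj z₀) * Complex.exp (z₀ * conj B) := by
      rw [← Complex.exp_add, haff z₀, map_add, map_mul, Complex.conj_ofReal]
      ring_nf
    rw [e2, e3] at e0
    refine mul_left_cancel₀ (mul_ne_zero (Complex.exp_ne_zero (A * z₀ * conj z₀))
      (mul_ne_zero hpz₀ hpz₀')) ?_
    linear_combination e0 + Complex.exp (A * z₀ * conj z₀) * (conj (p z₀) ^ m * e1 - p z₀ ^ m * e1')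
  obtain ⟨C, hC⟩ := Complex.conj_eq_iff_real.1 hcreal
  have hC0 : (C : ℂ) ≠ 0 := hC ▸ hc0
  -- The constant found so far multiplies `p u ^ m`; the required one stands on the other side,
  -- hence the inverse.
  refine ⟨A, C⁻¹, B, inv_ne_zero (by exact_mod_cast hC0), haff, fun u => ?_⟩
  rw [mul_assoc, hθc, hC, haff u, Complex.ofReal_inv, inv_mul_cancel_left₀ hC0]

/-! ### Kernels and the adjoint -/

/-- The function `u ↦ u ^ m * exp (u * conj z)`, which represents the evaluation of the `m`-th
derivative at `z`. -/
noncomputable def FockSpace.kernel (m : ℕ) (z : ℂ) : FockSpace :=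
  ⟨fun u => u ^ m * Complex.exp (u * conj z), by fun_prop, by
    have hi := integrable_exp_neg_mul_sq_norm_add one_pos (2 * m + 2 * ‖z‖)
    simp only [one_mul] at hi
    refine hi.mono' (Continuous.aestronglyMeasurable (by fun_prop))
      (Filter.Eventually.of_forall fun u => ?_)
    rw [Real.norm_eq_abs, abs_of_nonneg (by positivity), norm_mul, norm_pow, Real.exp_add,
      mul_comm]
    refine mul_le_mul_of_nonneg_left ?_ (Real.exp_pos _).le
    have h1 : ‖u‖ ^ m ≤ Real.exp (m * ‖u‖) := by
      rw [Real.exp_nat_mul]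
      exact pow_le_pow_left₀ (norm_nonneg u) (by linarith [Real.add_one_le_exp ‖u‖]) m
    have h2 : ‖Complex.exp (u * conj z)‖ ≤ Real.exp (‖z‖ * ‖u‖) := by
      simpa [mul_comm] using norm_exp_le (u * conj z)
    calc _ ≤ (Real.exp (m * ‖u‖) * Real.exp (‖z‖ * ‖u‖)) ^ 2 := by gcongr
      _ = _ := by
        rw [← Real.exp_add, ← Real.exp_nat_mul]
        push_cast
        ring_nf⟩

@[simp] theorem FockSpace.kernel_apply (m : ℕ) (z u : ℂ) :
    FockSpace.kernel m z u = u ^ m * Complex.exp (u * conj z) := rfl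

theorem FockSpace.inner_kernel (m : ℕ) (z : ℂ) (g : FockSpace) :
    inner ℂ (FockSpace.kernel m z) g = iteratedDeriv m g z := by
  have hpi : (Real.pi : ℂ) ≠ 0 := by exact_mod_cast Real.pi_ne_zero
  rw [FockSpace.inner_def, inv_mul_eq_iff_eq_mul₀ hpi,
    ← g.fockGrowth.integral_mul_conj_pow_mul_exp g.differentiable]
  congr 1
  ext u
  simp only [FockSpace.kernel_apply, map_mul, map_pow, ← Complex.exp_conj, Complex.conj_conj]
  rw [mul_comm (conj u) z]
  ring

theorem FockSpace.iteratedDeriv_kernel_zero (m : ℕ) (w u : ℂ) :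
    iteratedDeriv m (FockSpace.kernel 0 w) u = conj w ^ m * Complex.exp (u * conj w) := by
  have h : (FockSpace.kernel 0 w : ℂ → ℂ) = fun u => Complex.exp (conj w * u) := by
    ext u
    simp [mul_comm]
  rw [h, iteratedDeriv_cexp_const_mul, mul_comm u]

theorem mem_maximalOp {m : ℕ} {psi varphi phi : ℂ → ℂ} {f g : FockSpace} :
    (f, g) ∈ maximalOp m psi varphi phi ↔
      ∀ z, psi z * f (varphi z) = phi z * iteratedDeriv m g z := Iff.rfl

theorem mem_maximalOp_iff {m : ℕ} {psi varphi phi : ℂ → ℂ} (hpsi : ∀ z, psi z ≠ 0)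
    {f g : FockSpace} : (f, g) ∈ maximalOp m psi varphi phi ↔
      ∀ z, f (varphi z) = phi z / psi z * iteratedDeriv m g z := by
  rw [mem_maximalOp]
  refine forall_congr' fun z => ?_
  have := hpsi z
  constructor
  · intro h
    field_simp
    linear_combination h
  · intro h
    rw [h]
    field_simp

/-- The pairs of kernels that the adjoint of every weighted composition operator contains. -/
noncomputable def kernelPair (m : ℕ) (θ varphi : ℂ → ℂ) (z : ℂ) : FockSpace × FockSpace :=
  (conj (θ z) • FockSpace.kernel m z, FockSpace.kernel 0 (varphi z))

theorem inner_kernel_zero (w : ℂ) (f : FockSpace) : inner ℂ (FockSpace.kernel 0 w) f = f w := by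
  rw [FockSpace.inner_kernel, iteratedDeriv_zero]

/-- Pairing with the kernels turns the defining relation at the point `z` into the adjoint identity.
-/
theorem kernelPair_mem_adjoint {m : ℕ} {psi varphi phi : ℂ → ℂ} (hpsi : ∀ z, psi z ≠ 0)
    {S : MultiOp} (hS : S ≤ maximalOp m psi varphi phi) (z : ℂ) :
    kernelPair m (fun z => phi z / psi z) varphi z ∈ Submodule.adjoint S := by
  refine (MultiOp.mem_adjoint _ _ _).2 fun f g hfg => ?_
  have h := (mem_maximalOp_iff hpsi).1 (hS hfg) z
  rw [inner_smul_right, ← inner_conj_symm g, ← inner_conj_symm f, inner_kernel_zero,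
    FockSpace.inner_kernel, h, map_mul]

theorem kernelPair_mem_maximalOp_iff {m : ℕ} {psi varphi phi : ℂ → ℂ} (hpsi : ∀ z, psi z ≠ 0)
    (z : ℂ) : kernelPair m (fun z => phi z / psi z) varphi z ∈ maximalOp m psi varphi phi ↔
      ∀ u, conj (phi z / psi z) * varphi u ^ m * Complex.exp (varphi u * conj z) =
        phi u / psi u * conj (varphi z) ^ m * Complex.exp (u * conj (varphi z)) := by
  unfold kernelPair
  rw [mem_maximalOp_iff hpsi]
  simp only [FockSpace.smul_apply, FockSpace.kernel_apply, FockSpace.iteratedDeriv_kernel_zero,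
    mul_assoc]

/-! ### Self-adjointness of the maximal operator -/

theorem inner_comm_of_eq_pow_mul {m : ℕ} {f g a b : FockSpace} {h k : ℂ → ℂ}
    (hh : Differentiable ℂ h) (hk : Differentiable ℂ k) (hf : ∀ z, f z = z ^ m * h z)
    (ha : ∀ z, a z = z ^ m * k z)
    (hs : ∫ z : ℂ, conj (h z) * iteratedDeriv m b z * (Real.exp (-‖z‖ ^ 2) : ℝ) =
      conj (∫ z : ℂ, conj (k z) * iteratedDeriv m g z * (Real.exp (-‖z‖ ^ 2) : ℝ))) :
    (inner ℂ g a : ℂ) = inner ℂ f b := by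
  rw [← inner_conj_symm g, FockSpace.inner_def, FockSpace.inner_def, map_mul, map_inv₀,
    Complex.conj_ofReal, ← integral_conj_mul_iteratedDeriv hh hf,
    ← integral_conj_mul_iteratedDeriv hk ha, hs]

/-- Symmetry of the weighted composition operator with an affine symbol. -/
theorem inner_comm_of_affine {m : ℕ} {A C : ℝ} {B : ℂ} (hC : C ≠ 0) (hA0 : 1 ≤ m → A ≠ 0)
    {f g a b : FockSpace}
    (hfg : ∀ z, C * Complex.exp (z * conj B) * f (A * z + B) =
      (A * z + B) ^ m * iteratedDeriv m g z)
    (hab : ∀ z, C * Complex.exp (z * conj B) * a (A * z + B) =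
      (A * z + B) ^ m * iteratedDeriv m b z) :
    (inner ℂ g a : ℂ) = inner ℂ f b := by
  have hCc : (C : ℂ) ≠ 0 := by exact_mod_cast hC
  have hdd : ∀ q : FockSpace, Differentiable ℂ (iteratedDeriv m q) := fun q =>
    q.differentiable.contDiff.differentiable_iteratedDeriv m (by exact_mod_cast WithTop.coe_lt_top _)
  by_cases hA : A = 0
  -- In this degenerate case the operator has rank one: `g` is a multiple of the kernel at `B`, with
  -- the real factor `C` times `f B`.
  · have hm : m = 0 := by
      by_contra hm
      exact hA0 (Nat.one_le_iff_ne_zero.2 hm) hA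
    subst hm hA
    have key : ∀ {p q : FockSpace}, (∀ z, C * Complex.exp (z * conj B) * p ((0 : ℝ) * z + B) =
        ((0 : ℝ) * z + B) ^ 0 * iteratedDeriv 0 q z) →
        q = (C * p B) • FockSpace.kernel 0 B := by
      intro p q hpq
      refine FockSpace.ext fun z => ?_
      have := hpq z
      simp only [Complex.ofReal_zero, zero_mul, zero_add, pow_zero, one_mul,
        iteratedDeriv_zero] at this
      rw [← this]
      simp
      ring
    rw [key hfg, key hab, inner_smul_left, inner_smul_right, ← inner_conj_symm f,
      inner_kernel_zero, inner_kernel_zero, map_mul, Complex.conj_ofReal]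
    ring
  have hAc : (A : ℂ) ≠ 0 := by exact_mod_cast hA
  -- division of the first component by the `m`-th power of the variable
  have quot : ∀ {p q : FockSpace}, (∀ z, C * Complex.exp (z * conj B) * p (A * z + B) =
      (A * z + B) ^ m * iteratedDeriv m q z) → ∃ h : ℂ → ℂ, Differentiable ℂ h ∧
      (∀ z, p z = z ^ m * h z) ∧ (∀ z, iteratedDeriv m q z =
        C * (Complex.exp (z * conj B) * h (A * z + B))) ∧
      ∀ z, h z = ((C⁻¹ * Real.exp (‖B‖ ^ 2 / A) : ℝ) : ℂ) * (Complex.exp (z * conj (-B / A)) *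
        iteratedDeriv m q ((A⁻¹ : ℝ) * z + -B / A)) := by
    intro p q hpq
    have e : ∀ z : ℂ, ((A⁻¹ : ℝ) : ℂ) * z + -B / A = (z - B) / A := fun z => by
      push_cast
      ring
    -- Inverting the affine map gives slope `A⁻¹` and shift `-B / A`; the factor `exp (‖B‖ ^ 2 / A)`
    -- brings the inverse weight to the form `exp (z * conj B')` with `B' = -B / A`, as the symmetry
    -- lemma requires.
    have ee : ∀ z : ℂ, ((Real.exp (‖B‖ ^ 2 / A) : ℝ) : ℂ) * Complex.exp (z * conj (-B / A)) =
        Complex.exp (-((z - B) / A * conj B)) := fun z => by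
      rw [Complex.ofReal_exp, ← Complex.exp_add]
      congr 1
      push_cast
      rw [← Complex.mul_conj', map_div₀, map_neg, Complex.conj_ofReal]
      field_simp
      ring
    have hq := hdd q
    have hdef : ∀ z, ((C⁻¹ * Real.exp (‖B‖ ^ 2 / A) : ℝ) : ℂ) * (Complex.exp (z * conj (-B / A)) *
        iteratedDeriv m q ((A⁻¹ : ℝ) * z + -B / A)) =
        (C : ℂ)⁻¹ * Complex.exp (-((z - B) / A * conj B)) * iteratedDeriv m q ((z - B) / A) := by
      intro z
      rw [← ee, e, Complex.ofReal_mul, Complex.ofReal_inv]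
      ring
    refine ⟨fun z => ((C⁻¹ * Real.exp (‖B‖ ^ 2 / A) : ℝ) : ℂ) *
      (Complex.exp (z * conj (-B / A)) * iteratedDeriv m q ((A⁻¹ : ℝ) * z + -B / A)),
      by fun_prop, fun z => ?_, fun z => ?_, fun z => rfl⟩
    · have h1 := hpq ((z - B) / A)
      have h2 : (A : ℂ) * ((z - B) / A) + B = z := by
        field_simp
        ring
      rw [h2] at h1
      simp only
      rw [hdef, Complex.exp_neg]
      have h3 := Complex.exp_ne_zero ((z - B) / A * conj B)
      rw [mul_assoc, mul_left_comm, mul_left_comm (z ^ m), ← h1]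
      field_simp
    · simp only
      rw [hdef]
      have h2 : (A * z + B - B) / (A : ℂ) = z := by
        field_simp
        ring
      rw [h2, Complex.exp_neg]
      have h3 := Complex.exp_ne_zero (z * conj B)
      field_simp
  obtain ⟨h, hh, hf, hg, hhg⟩ := quot hfg
  obtain ⟨k, hk, ha, hb, hkb⟩ := quot hab
  refine inner_comm_of_eq_pow_mul hh hk hf ha ?_
  have i1 := integrable_conj_mul_iteratedDeriv hh.continuous hf b
  have i2 := integrable_conj_mul_iteratedDeriv hk.continuous ha g
  rcases le_or_gt |A| 1 with hA1 | hA1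
  · have pull : ∀ {x y : ℂ → ℂ} (z : ℂ), conj (x z) *
        (C * (Complex.exp (z * conj B) * y (A * z + B))) * (Real.exp (-‖z‖ ^ 2) : ℝ) =
        C * (conj (x z) * (Complex.exp (z * conj B) * y (A * z + B)) *
          (Real.exp (-‖z‖ ^ 2) : ℝ)) := fun z => by ring
    simp only [hg, hb, pull] at i1 i2 ⊢
    rw [integral_const_mul, integral_const_mul, map_mul, Complex.conj_ofReal]
    rw [integrable_const_mul_iff (isUnit_iff_ne_zero.2 hCc)] at i1 i2
    rw [integral_conj_mul_weightedComposition (fockGrowth_of_eq_pow_mul hh.continuous hf) hh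
      (fockGrowth_of_eq_pow_mul hk.continuous ha) hk hA1 i1 i2]
  -- The inverse operator, with slope `A⁻¹`, is applied to the derivatives instead; they still have
  -- Fock growth.
  · set c : ℝ := C⁻¹ * Real.exp (‖B‖ ^ 2 / A) with hc
    have hc0 : (c : ℂ) ≠ 0 := by
      rw [hc]
      exact_mod_cast mul_ne_zero (inv_ne_zero hC) (Real.exp_pos _).ne'
    have hA2 : |A⁻¹| ≤ 1 := by
      rw [abs_inv]
      exact inv_le_one_of_one_le₀ hA1.le
    have swap : ∀ x y : ℂ → ℂ, (fun z : ℂ => conj (x z) * y z * ((Real.exp (-‖z‖ ^ 2) : ℝ) : ℂ)) =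
        fun z => conj (conj (y z) * x z * ((Real.exp (-‖z‖ ^ 2) : ℝ) : ℂ)) := fun x y => by
      ext z
      simp only [map_mul, Complex.conj_conj, Complex.conj_ofReal]
      ring
    have pull : ∀ {x y : ℂ → ℂ} (z : ℂ), conj (x z) *
        (c * (Complex.exp (z * conj (-B / A)) * y ((A⁻¹ : ℝ) * z + -B / A))) *
          (Real.exp (-‖z‖ ^ 2) : ℝ) =
        c * (conj (x z) * (Complex.exp (z * conj (-B / A)) * y ((A⁻¹ : ℝ) * z + -B / A)) *
          (Real.exp (-‖z‖ ^ 2) : ℝ)) := fun z => by ring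
    have j1 : Integrable fun z : ℂ =>
        conj (iteratedDeriv m b z) * h z * ((Real.exp (-‖z‖ ^ 2) : ℝ) : ℂ) := by
      rw [swap]
      exact (LinearIsometryEquiv.integrable_comp_iff (RCLike.conjLIE (K := ℂ))).2 i1
    have j2 : Integrable fun z : ℂ =>
        conj (iteratedDeriv m g z) * k z * ((Real.exp (-‖z‖ ^ 2) : ℝ) : ℂ) := by
      rw [swap]
      exact (LinearIsometryEquiv.integrable_comp_iff (RCLike.conjLIE (K := ℂ))).2 i2
    rw [swap h, swap k, integral_conj, integral_conj, Complex.conj_conj]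
    simp only [hhg, hkb, pull] at j1 j2 ⊢
    rw [integral_const_mul, integral_const_mul, map_mul, Complex.conj_ofReal]
    rw [integrable_const_mul_iff (isUnit_iff_ne_zero.2 hc0)] at j1 j2
    rw [← integral_conj_mul_weightedComposition (g.fockGrowth.iteratedDeriv g.differentiable m)
      (hdd g) (b.fockGrowth.iteratedDeriv b.differentiable m) (hdd b) hA2 j2 j1]

theorem isHermitian_maximalOp {m : ℕ} {psi varphi phi : ℂ → ℂ} (hpsi0 : ∀ z, psi z ≠ 0)
    {A C : ℝ} {B : ℂ} (hC : C ≠ 0) (hA0 : 1 ≤ m → A ≠ 0) (hvarphi : ∀ u, varphi u = A * u + B)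
    (hsym : ∀ u, C * Complex.exp (u * conj B) * (phi u / psi u) = (A * u + B) ^ m) :
    (maximalOp m psi varphi phi).IsHermitian := by
  have hCc : (C : ℂ) ≠ 0 := by exact_mod_cast hC
  have key : ∀ {f g : FockSpace}, (f, g) ∈ maximalOp m psi varphi phi →
      ∀ z, C * Complex.exp (z * conj B) * f (A * z + B) =
        (A * z + B) ^ m * iteratedDeriv m g z := by
    intro f g hfg z
    rw [← hvarphi, (mem_maximalOp_iff hpsi0).1 hfg z, ← mul_assoc, hsym, hvarphi]
  refine le_antisymm ?_ ?_
  · rintro ⟨a, b⟩ hab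
    rw [mem_maximalOp_iff hpsi0]
    intro z
    -- Testing an element of the adjoint against this pair yields the defining relation of the
    -- maximal operator at `z`.
    have hmem : kernelPair m (fun z => phi z / psi z) varphi z ∈ maximalOp m psi varphi phi := by
      rw [kernelPair_mem_maximalOp_iff hpsi0]
      intro u
      have hθ : ∀ w, phi w / psi w =
          (C : ℂ)⁻¹ * Complex.exp (-(w * conj B)) * varphi w ^ m := fun w => by
        rw [hvarphi, ← hsym, Complex.exp_neg]
        have := Complex.exp_ne_zero (w * conj B)
        field_simp
      have e : Complex.exp (-(conj z * B)) * Complex.exp (varphi u * conj z) =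
          Complex.exp (-(u * conj B)) * Complex.exp (u * conj (varphi z)) := by
        rw [← Complex.exp_add, ← Complex.exp_add, hvarphi, hvarphi, map_add, map_mul,
          Complex.conj_ofReal]
        ring_nf
      rw [hθ, hθ]
      simp only [map_mul, map_inv₀, map_pow, map_neg, ← Complex.exp_conj, Complex.conj_conj,
        Complex.conj_ofReal]
      linear_combination (C : ℂ)⁻¹ * conj (varphi z) ^ m * varphi u ^ m * e
    have h := (MultiOp.mem_adjoint _ _ _).1 hab _ _ hmem
    rwa [inner_kernel_zero, inner_smul_left, Complex.conj_conj, FockSpace.inner_kernel] at h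
  · rintro ⟨a, b⟩ hab
    exact (MultiOp.mem_adjoint _ _ _).2 fun f g hfg =>
      inner_comm_of_affine hC hA0 (key hfg) (key hab)

theorem adjoint_anti {S T : MultiOp} (h : S ≤ T) : Submodule.adjoint T ≤ Submodule.adjoint S := by
  rintro ⟨a, b⟩ hab
  exact (MultiOp.mem_adjoint _ _ _).2 fun f g hfg =>
    (MultiOp.mem_adjoint _ _ _).1 hab f g (h hfg)

theorem mainTheorem4 (m : ℕ) (psi varphi phi : ℂ → ℂ)
    (hpsi : Differentiable ℂ psi) (hvarphi : Differentiable ℂ varphi) (hphi : Differentiable ℂ phi)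
    (hphi0 : ∃ z : ℂ, phi z ≠ 0) (hpsi0 : ∀ z : ℂ, psi z ≠ 0)
    (hvarphic : 1 ≤ m → ¬ ∃ c : ℂ, ∀ z : ℂ, varphi z = c)
    (S : MultiOp) (hS : IsWeightedCompositionOp m psi varphi phi S) :
    S.IsHermitian ↔
      S = maximalOp m psi varphi phi ∧
      ∃ psi₁ varphi₁ phi₁ : ℂ → ℂ,
        Differentiable ℂ psi₁ ∧ Differentiable ℂ varphi₁ ∧ Differentiable ℂ phi₁ ∧
        (∀ z : ℂ, psi₁ z ≠ 0) ∧
        SymbolsEquivalent psi varphi phi psi₁ varphi₁ phi₁ ∧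
        ∃ (A C : ℝ) (B : ℂ), C ≠ 0 ∧
          (∀ u : ℂ, varphi₁ u = (A : ℂ) * u + B) ∧
          ∀ u : ℂ, (C : ℂ) * Complex.exp (u * conj B) * phi₁ u =
            psi₁ u * ((A : ℂ) * u + B) ^ m := by
  have hA0 : ∀ {A : ℝ} {B : ℂ}, (∀ u, varphi u = A * u + B) → 1 ≤ m → A ≠ 0 := by
    rintro A B h hm rfl
    exact hvarphic hm ⟨B, fun z => by simp [h]⟩
  constructor
  · intro hH
    have hH' : Submodule.adjoint S = S := hH
    have hS' : S ≤ maximalOp m psi varphi phi := hS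
    have hmem : ∀ z, kernelPair m (fun z => phi z / psi z) varphi z ∈
        maximalOp m psi varphi phi := fun z => by
      refine hS' ?_
      have := kernelPair_mem_adjoint hpsi0 hS' z
      rwa [hH'] at this
    obtain ⟨A, C, B, hC, hv, hsym⟩ := symbols_of_functional_equation (m := m)
      (hphi.div hpsi hpsi0) hvarphi
      (hphi0.imp fun z hz => div_ne_zero hz (hpsi0 z)) hvarphic
      fun z u => (kernelPair_mem_maximalOp_iff hpsi0 z).1 (hmem z) u
    refine ⟨le_antisymm hS' ?_, psi, varphi, phi, hpsi, hvarphi, hphi, hpsi0,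
      ⟨rfl, fun z => rfl⟩, A, C, B, hC, hv, fun u => ?_⟩
    -- Taking adjoints reverses inclusions, so maximality follows from the self-adjointness of the
    -- maximal operator.
    · have hT : Submodule.adjoint (maximalOp m psi varphi phi) = maximalOp m psi varphi phi :=
        isHermitian_maximalOp hpsi0 hC (hA0 hv) hv hsym
      rw [← hT, ← hH']
      exact adjoint_anti hS'
    · rw [← hsym u]
      have := hpsi0 u
      simp only [Pi.div_apply]
      field_simp
  · rintro ⟨rfl, psi₁, _, phi₁, -, -, -, hpsi₁, ⟨rfl, heq⟩, A, C, B, hC, hv, hsym⟩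
    refine isHermitian_maximalOp hpsi0 hC (hA0 hv) hv fun u => ?_
    rw [heq, ← mul_div_assoc, hsym, mul_div_cancel_left₀ _ (hpsi₁ u)]
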